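/- Let $n\ge 1$ and let $\mathbf A$ be an $n\times n$ Hermitian matrix (real symmetric or complex Hermitian) with eigendecomposition $\mathbf A=\sum_{i=1}^n\lambda_i\mathbf u_i\mathbf u_i^{\mathsf H}$, where $\mathbf u_1,\dots,\mathbf u_n$ are orthonormal, and let $\lambda_{\max}$ and $\lambda_{\min}$ be its largest and smallest eigenvalues. Let $\Phi(x)=\sum_{i=1}^n\frac1n\mathbb 1(\lambda_i\le x)$ be the cumulative empirical spectral measure (CESM) of $\mathbf A$. Fix an integer $n_{\mathrm v}>0$ and let $\mathbf v_1,\dots,\mathbf v_{n_{\mathrm v}}$ be independent random vectors, each uniformly distributed on the real unit sphere $\mathbb S^{n-1}=\{\mathbf u\in\mathbb R^n:\|\mathbf u\|_2=1\}$. For each $\ell$ let $\Psi_\ell(x)=\sum_{i=1}^n|\mathbf v_\ell^{\mathsf H}\mathbf u_i|^2\,\mathbb 1(\lambda_i\le x)$ be the weighted CESM, and let $\langle\Psi_\ell\rangle=\frac1{n_{\mathrm v}}\sum_{\ell=1}^{n_{\mathrm v}}\Psi_\ell$ be the averaged weighted CESM. Write $d_{\mathrm W}(\Upsilon_1,\Upsilon_2)=\int_{\mathbb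 R}|\Upsilon_1(x)-\Upsilon_2(x)|\,dx$ for the Wasserstein distance of two distribution functions. Then, for all $\varepsilon>0$, $$\mathbb P\big[d_{\mathrm W}(\Phi,\langle\Psi_\ell\rangle)>\varepsilon(\lambda_{\max}-\lambda_{\min})\big]\le 2n\exp\!\big(-n_{\mathrm v}(n+2)\varepsilon^2\big).$$ -/

import Mathlib

open MeasureTheory ProbabilityTheory

noncomputable section

/-- The uniform probability distribution on the real unit sphere of `ℝⁿ`, viewed as a measure on
`ℝⁿ`: the normalized surface measure of the sphere, pushed forward along the inclusion. -/
def unifSphere (n : ℕ) : Measure (EuclideanSpace ℝ (Fin n)) :=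
  (ProbabilityTheory.cond (volume : Measure (EuclideanSpace ℝ (Fin n))).toSphere Set.univ).map
    Subtype.val

/-- A real vector, viewed as a vector with entries in `𝕜`. -/
def toField (𝕜 : Type*) [RCLike 𝕜] {n : ℕ} (v : EuclideanSpace ℝ (Fin n)) :
    EuclideanSpace 𝕜 (Fin n) :=
  WithLp.toLp 2 fun j => ((v j : ℝ) : 𝕜)

variable {𝕜 : Type*} [RCLike 𝕜] {n : ℕ} {A : Matrix (Fin n) (Fin n) 𝕜}

/-- The cumulative empirical spectral measure `Φ(x) = ∑ᵢ n⁻¹ 𝟙(λᵢ ≤ x)` of a Hermitian matrix. -/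
def CESM (hA : A.IsHermitian) (x : ℝ) : ℝ :=
  ∑ i, (1 / (n : ℝ)) * (if hA.eigenvalues i ≤ x then 1 else 0)

/-- The weighted cumulative empirical spectral measure
`Ψ(x) = ∑ᵢ |vᴴ uᵢ|² 𝟙(λᵢ ≤ x)` of a Hermitian matrix with eigenvalues `λᵢ` and an orthonormal
basis of eigenvectors `uᵢ`; here `inner 𝕜 v uᵢ` is `vᴴ uᵢ`. -/
def weightedCESM (hA : A.IsHermitian) (v : EuclideanSpace ℝ (Fin n)) (x : ℝ) : ℝ :=
  ∑ i, ‖inner 𝕜 (toField 𝕜 v) (hA.eigenvectorBasis i)‖ ^ 2 *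
    (if hA.eigenvalues i ≤ x then 1 else 0)

/-- The average `⟨Ψ_ℓ⟩ = n_v⁻¹ ∑_ℓ Ψ_ℓ` of the weighted CESMs of `n_v` vectors. -/
def avgWeightedCESM (hA : A.IsHermitian) {nv : ℕ} (v : Fin nv → EuclideanSpace ℝ (Fin n))
    (x : ℝ) : ℝ :=
  (1 / (nv : ℝ)) * ∑ l, weightedCESM hA (v l) x

/-- The largest eigenvalue. -/
def lamMax (hA : A.IsHermitian) : ℝ := ⨆ i, hA.eigenvalues i

/-- The smallest eigenvalue. -/
def lamMin (hA : A.IsHermitian) : ℝ := ⨅ i, hA.eigenvalues i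

/-- The Wasserstein distance `∫ |Υ₁ - Υ₂| dx` of two distribution functions, with values
in `[0, ∞]`. -/
def dW (Υ₁ Υ₂ : ℝ → ℝ) : ENNReal := ∫⁻ x, ENNReal.ofReal |Υ₁ x - Υ₂ x|

end

open scoped Matrix

/-! Both distribution functions are constant between consecutive eigenvalues and agree outside
`[λ_min, λ_max)`. If they differ by at most `ε` at every eigenvalue, the integral is at most `ε
(λ_max - λ_min)`, and a union bound over the `n` eigenvalues leaves one two-sided tail estimate.

At a fixed eigenvalue, `Ψ_ℓ` is a quadratic form `q(v) = vᵀ M v`, where `M` is the real part of a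
spectral projection and satisfies `|M v|² ≤ q(v)`. Integration by parts along rotations of the
sphere gives `E[(tr M - n q + 2x(|M v|² - q²)) e^{xq}] = 0`. For `x ≥ 0`, `y(x) = E e^{xq}` is thus
a subsolution of Kummer's equation with `a = tr M / 2`, `b = n / 2`; equality is the Beta case.
`kummer_subsolution_le_exp` turns this into a sub-Gaussian bound with variance proxy `1 / (2(n+2))`,
and negative `x` follows by passing to `1 - M`. The Chernoff bound for `n_v` independent copies then
gives the exponent `n_v (n+2) ε²`. -/

/-! ### A comparison principle for Kummer's equation -/

/-- With `W` the exponent and `w = W'`, it suffices that `y' ≤ w y`, since then `e^{-W} y`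
decreases. The defect `y' - w y` satisfies a first-order differential inequality, whose integrating
factor is `x^b e^{W - x}`. -/
theorem kummer_subsolution_le_exp {a b : ℝ} (hb : 0 < b) {y y' y'' : ℝ → ℝ}
    (hy : ∀ x, HasDerivAt y (y' x) x) (hy' : ∀ x, HasDerivAt y' (y'' x) x) (hy0 : y 0 = 1)
    (hpos : ∀ x, 0 ≤ y x) (hode : ∀ x, 0 ≤ x → x * y'' x ≤ a * y x - (b - x) * y' x)
    {x : ℝ} (hx : 0 ≤ x) : y x ≤ Real.exp (a / b * x + x ^ 2 / (8 * (b + 1))) := by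
  -- The choice `(b + 1) c = 1/4` completes the square: `w² - w + (b + 1) c = (w - 1/2)²`.
  set c : ℝ := 1 / (4 * (b + 1)) with hc
  have hcb : (b + 1) * c = 1 / 4 := by rw [hc]; field_simp
  set w : ℝ → ℝ := fun x => a / b + c * x with hw
  set W : ℝ → ℝ := fun x => a / b * x + x ^ 2 / (8 * (b + 1)) with hW
  have hwd (x : ℝ) : HasDerivAt w c x := by
    simpa only [mul_one] using ((hasDerivAt_id' x).const_mul c).const_add (a / b)
  have hWd (x : ℝ) : HasDerivAt W (w x) x := by
    have := ((hasDerivAt_id x).const_mul (a / b)).add ((hasDerivAt_pow 2 x).div_const (8 * (b + 1)))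
    convert! this using 1
    simp only [hw, hc]
    field_simp
    ring
  set H : ℝ → ℝ := fun x => x ^ b * (Real.exp (W x - x) * (y' x - w x * y x)) with hH
  have hHd (x : ℝ) (hx : 0 < x) : HasDerivAt H (b * x ^ (b - 1) *
      (Real.exp (W x - x) * (y' x - w x * y x)) + x ^ b * (Real.exp (W x - x) * (w x - 1) *
      (y' x - w x * y x) + Real.exp (W x - x) * (y'' x - (c * y x + w x * y' x)))) x :=
    (Real.hasDerivAt_rpow_const (Or.inl hx.ne')).mul
      ((((hWd x).sub (hasDerivAt_id x)).exp).mul ((hy' x).sub ((hwd x).mul (hy x))))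
  have hcont : Continuous H := by
    have h1 : Continuous y := continuous_iff_continuousAt.2 fun x => (hy x).continuousAt
    have h2 : Continuous y' := continuous_iff_continuousAt.2 fun x => (hy' x).continuousAt
    have h3 : Continuous fun x : ℝ => x ^ b := Real.continuous_rpow_const hb.le
    have h4 : Continuous w := by fun_prop
    have h5 : Continuous W := by fun_prop
    fun_prop
  have hanti : AntitoneOn H (Set.Ici 0) := by
    refine antitoneOn_of_deriv_nonpos (convex_Ici 0) hcont.continuousOn ?_ ?_
    · intro x hx
      rw [interior_Ici] at hx
      exact (hHd x hx).differentiableAt.differentiableWithinAt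
    · intro x hx
      rw [interior_Ici] at hx
      replace hx : 0 < x := hx
      rw [(hHd x hx).deriv]
      have hxb : x ^ b = x ^ (b - 1) * x := by
        rw [Real.rpow_sub_one hx.ne']; field_simp
      have key : b * (y' x - w x * y x) + x * ((w x - 1) * (y' x - w x * y x) +
          (y'' x - (c * y x + w x * y' x))) ≤ 0 := by
        have h1 := hode x hx.le
        have h2 : 0 ≤ x * y x * (w x - 1 / 2) ^ 2 :=
          mul_nonneg (mul_nonneg hx.le (hpos x)) (sq_nonneg _)
        have h3 : b * w x = a + b * c * x := by simp only [hw]; field_simp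
        have h4 : b * (y' x - w x * y x) + x * ((w x - 1) * (y' x - w x * y x) +
          (y'' x - (c * y x + w x * y' x))) = (x * y'' x - (a * y x - (b - x) * y' x))
            - x * y x * (w x - 1 / 2) ^ 2 := by
          linear_combination (-y x) * h3 - x * y x * hcb
        linarith
      have : 0 ≤ x ^ (b - 1) * Real.exp (W x - x) := by positivity
      rw [hxb]
      calc _ = x ^ (b - 1) * Real.exp (W x - x) * (b * (y' x - w x * y x) +
          x * ((w x - 1) * (y' x - w x * y x) + (y'' x - (c * y x + w x * y' x)))) := by ring
        _ ≤ 0 := mul_nonpos_of_nonneg_of_nonpos this key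
  have hle (x : ℝ) (hx : 0 < x) : y' x ≤ w x * y x := by
    have h1 := hanti Set.self_mem_Ici hx.le hx.le
    -- The factor `x^b` vanishes at `0`, so no initial condition on `y'` is needed.
    have h2 : H 0 = 0 := by simp [hH, Real.zero_rpow hb.ne']
    rw [h2] at h1
    have h3 : 0 < x ^ b := Real.rpow_pos_of_pos hx b
    have h4 := Real.exp_pos (W x - x)
    by_contra! h5
    have : 0 < H x := mul_pos h3 (mul_pos h4 (by linarith))
    linarith
  have hKd (x : ℝ) : HasDerivAt (fun x => Real.exp (-W x) * y x)
      (Real.exp (-W x) * (-w x) * y x + Real.exp (-W x) * y' x) x :=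
    ((hWd x).neg.exp).mul (hy x)
  have hanti' : AntitoneOn (fun x => Real.exp (-W x) * y x) (Set.Ici 0) := by
    refine antitoneOn_of_deriv_nonpos (convex_Ici 0) (fun x _ =>
      (hKd x).continuousAt.continuousWithinAt) (fun x _ =>
      (hKd x).differentiableAt.differentiableWithinAt) ?_
    intro x hx
    rw [interior_Ici] at hx
    rw [(hKd x).deriv]
    have := mul_nonneg (Real.exp_pos (-W x)).le (sub_nonneg.2 (hle x hx))
    linarith
  have h1 := hanti' Set.self_mem_Ici hx hx
  have h2 : W 0 = 0 := by simp [hW]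
  simp only [h2, neg_zero, Real.exp_zero, hy0, one_mul] at h1
  rw [Real.exp_neg, inv_mul_le_iff₀ (Real.exp_pos _), mul_one] at h1
  exact h1

/-! ### Rotation invariance and integration by parts on the sphere -/

theorem isProbabilityMeasure_unifSphere {n : ℕ} (hn : 0 < n) :
    IsProbabilityMeasure (unifSphere n) := by
  have : Nonempty (Fin n) := ⟨⟨0, hn⟩⟩
  have : IsProbabilityMeasure (ProbabilityTheory.cond
      (volume : Measure (EuclideanSpace ℝ (Fin n))).toSphere Set.univ) :=
    cond_isProbabilityMeasure (by
      rw [Ne, Measure.measure_univ_eq_zero]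
      exact Measure.toSphere_ne_zero _)
  exact Measure.isProbabilityMeasure_map measurable_subtype_coe.aemeasurable

theorem ae_unifSphere_norm_eq_one (n : ℕ) : ∀ᵐ v ∂unifSphere n, ‖v‖ = 1 := by
  rw [unifSphere, ae_map_iff measurable_subtype_coe.aemeasurable
    (measurableSet_eq_fun measurable_norm measurable_const)]
  exact .of_forall fun x => by simp

open scoped Pointwise in
theorem unifSphere_apply {n : ℕ} {s : Set (EuclideanSpace ℝ (Fin n))} (hs : MeasurableSet s) :
    unifSphere n s = ((volume : Measure (EuclideanSpace ℝ (Fin n))).toSphere Set.univ)⁻¹ *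
      (n * volume (Set.Ioo (0 : ℝ) 1 • (Metric.sphere (0 : EuclideanSpace ℝ (Fin n)) 1 ∩ s))) := by
  rw [unifSphere, Measure.map_apply measurable_subtype_coe hs, ProbabilityTheory.cond,
    Measure.restrict_univ, Measure.smul_apply, smul_eq_mul,
    Measure.toSphere_apply' _ (measurable_subtype_coe hs), Subtype.image_preimage_coe]
  simp

-- Surface measure is proportional to the volume of the cone over a set; a linear isometry commutes
-- with forming cones and preserves volume.
open scoped Pointwise in
theorem map_unifSphere_linearIsometryEquiv {n : ℕ}
    (e : EuclideanSpace ℝ (Fin n) ≃ₗᵢ[ℝ] EuclideanSpace ℝ (Fin n)) :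
    (unifSphere n).map e = unifSphere n := by
  ext s hs
  rw [Measure.map_apply e.continuous.measurable hs, unifSphere_apply hs,
    unifSphere_apply (e.continuous.measurable hs)]
  congr 2
  have : Set.Ioo (0 : ℝ) 1 • (Metric.sphere (0 : EuclideanSpace ℝ (Fin n)) 1 ∩ e ⁻¹' s) =
      e ⁻¹' (Set.Ioo (0 : ℝ) 1 • (Metric.sphere (0 : EuclideanSpace ℝ (Fin n)) 1 ∩ s)) := by
    ext v
    simp only [Set.mem_smul, Set.mem_preimage, Set.mem_inter_iff, mem_sphere_zero_iff_norm]
    constructor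
    · rintro ⟨r, hr, w, ⟨hw, hws⟩, rfl⟩
      exact ⟨r, hr, e w, ⟨by simpa using hw, hws⟩, by simp⟩
    · rintro ⟨r, hr, w, ⟨hw, hws⟩, h⟩
      refine ⟨r, hr, e.symm w, ⟨by simpa using hw, by simpa using hws⟩, ?_⟩
      apply e.injective
      simpa using h
  rw [this]
  exact e.measurePreserving.measure_preimage_equiv (f := e.toHomeomorph.toMeasurableEquiv) _

/-- The generator `v ↦ vᵢ eⱼ - vⱼ eᵢ` of the rotations in a coordinate plane. -/
noncomputable def rotGen {n : ℕ} (i j : Fin n) (v : EuclideanSpace ℝ (Fin n)) : EuclideanSpace ℝ (Fin n) :=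
  v i • EuclideanSpace.single j 1 - v j • EuclideanSpace.single i 1

theorem rotGen_apply {n : ℕ} (i j : Fin n) (v : EuclideanSpace ℝ (Fin n)) (k : Fin n) :
    rotGen i j v k = v i * (if k = j then 1 else 0) - v j * (if k = i then 1 else 0) := by
  simp [rotGen]

/-- The rotation by the angle `t` in a coordinate plane. -/
noncomputable def planeRot {n : ℕ} (i j : Fin n) (t : ℝ) :
    EuclideanSpace ℝ (Fin n) →ₗ[ℝ] EuclideanSpace ℝ (Fin n) where
  toFun v := v + (((Real.cos t - 1) * v i - Real.sin t * v j) • EuclideanSpace.single i 1 +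
    (Real.sin t * v i + (Real.cos t - 1) * v j) • EuclideanSpace.single j 1)
  map_add' v w := by
    ext k
    simp
    split_ifs <;> ring
  map_smul' r v := by
    ext k
    simp
    split_ifs <;> ring

theorem planeRot_apply {n : ℕ} (i j : Fin n) (t : ℝ) (v : EuclideanSpace ℝ (Fin n)) :
    planeRot i j t v = v + (((Real.cos t - 1) * v i - Real.sin t * v j) •
      EuclideanSpace.single i 1 + (Real.sin t * v i + (Real.cos t - 1) * v j) •
      EuclideanSpace.single j 1) := rfl

theorem norm_planeRot {n : ℕ} {i j : Fin n} (hij : i ≠ j) (t : ℝ)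
    (v : EuclideanSpace ℝ (Fin n)) : ‖planeRot i j t v‖ = ‖v‖ := by
  rw [← sq_eq_sq₀ (norm_nonneg _) (norm_nonneg _), planeRot_apply, norm_add_sq_real,
    norm_add_sq_real, inner_add_right]
  simp [norm_smul, inner_smul_left, inner_smul_right,
    EuclideanSpace.inner_single_right, hij]
  linear_combination (v i ^ 2 + v j ^ 2) * Real.sin_sq_add_cos_sq t

theorem hasDerivAt_planeRot {n : ℕ} {i j : Fin n} (hij : i ≠ j) (t : ℝ)
    (v : EuclideanSpace ℝ (Fin n)) :
    HasDerivAt (fun t => planeRot i j t v) (rotGen i j (planeRot i j t v)) t := by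
  have h1 := ((((Real.hasDerivAt_cos t).sub_const 1).mul_const (v i)).sub
    ((Real.hasDerivAt_sin t).mul_const (v j))).smul_const
      (EuclideanSpace.single i (1 : ℝ))
  have h2 := (((Real.hasDerivAt_sin t).mul_const (v i)).add
    (((Real.hasDerivAt_cos t).sub_const 1).mul_const (v j))).smul_const
      (EuclideanSpace.single j (1 : ℝ))
  convert! (h1.add h2).const_add v using 1
  simp only [rotGen, planeRot_apply]
  ext k
  simp [hij, hij.symm]
  split_ifs <;> ring

theorem integrable_unifSphere {n : ℕ} (hn : 0 < n) {f : EuclideanSpace ℝ (Fin n) → ℝ}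
    (hf : Continuous f) : Integrable f (unifSphere n) := by
  have := isProbabilityMeasure_unifSphere hn
  obtain ⟨C, hC⟩ := (isCompact_sphere (0 : EuclideanSpace ℝ (Fin n)) 1).exists_bound_of_continuousOn
    hf.continuousOn
  refine Integrable.of_bound hf.aestronglyMeasurable C ?_
  filter_upwards [ae_unifSphere_norm_eq_one n] with v hv
  exact hC v (by simpa using hv)

/-- The integral of `f` composed with the rotation by `t` is independent of `t`; differentiate it
under the integral at `t = 0`. The derivative may be taken along the tangent line instead of the
rotation orbit because `f` is differentiable. -/
theorem integral_unifSphere_deriv_rotGen {n : ℕ} (i j : Fin n)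
    {f g : EuclideanSpace ℝ (Fin n) → ℝ} (hf : Differentiable ℝ f) (hg : Continuous g)
    (hfg : ∀ v, HasDerivAt (fun t : ℝ => f (v + t • rotGen i j v)) (g v) 0) :
    ∫ v, g v ∂unifSphere n = 0 := by
  have hn : 0 < n := i.pos
  have := isProbabilityMeasure_unifSphere hn
  have hg' (v : EuclideanSpace ℝ (Fin n)) : g v = fderiv ℝ f v (rotGen i j v) := by
    refine (hfg v).unique ?_
    have h1 : HasDerivAt (fun t : ℝ => v + t • rotGen i j v) (rotGen i j v) 0 := by
      simpa using ((hasDerivAt_id (0 : ℝ)).smul_const (rotGen i j v)).const_add v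
    have h2 : HasFDerivAt f (fderiv ℝ f v) (v + (0 : ℝ) • rotGen i j v) := by
      simpa using (hf v).hasFDerivAt
    exact h2.comp_hasDerivAt 0 h1
  rcases eq_or_ne i j with rfl | hij
  · simp [hg', rotGen]
  have hrot (t : ℝ) : ∃ e : EuclideanSpace ℝ (Fin n) ≃ₗᵢ[ℝ] EuclideanSpace ℝ (Fin n),
      ∀ v, e v = planeRot i j t v :=
    ⟨LinearIsometry.toLinearIsometryEquiv ⟨planeRot i j t, norm_planeRot hij t⟩ rfl, fun v => rfl⟩
  have hinv (t : ℝ) : ∫ v, f (planeRot i j t v) ∂unifSphere n = ∫ v, f v ∂unifSphere n := by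
    obtain ⟨e, he⟩ := hrot t
    conv_rhs => rw [← map_unifSphere_linearIsometryEquiv e,
      integral_map e.continuous.aemeasurable hf.continuous.aestronglyMeasurable]
    simp [he]
  have hcont (t : ℝ) : Continuous (planeRot i j t) := by
    obtain ⟨e, he⟩ := hrot t
    rw [← funext he]
    exact e.continuous
  obtain ⟨C, hC⟩ := (isCompact_sphere (0 : EuclideanSpace ℝ (Fin n)) 1).exists_bound_of_continuousOn
    hg.continuousOn
  have key := (hasDerivAt_integral_of_dominated_loc_of_deriv_le (μ := unifSphere n)
    (F := fun t v => f (planeRot i j t v)) (F' := fun t v => g (planeRot i j t v))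
    (x₀ := (0 : ℝ)) (s := Set.univ) (bound := fun _ => C) Filter.univ_mem
    (.of_forall fun t => (hf.continuous.comp (hcont t)).aestronglyMeasurable)
    (integrable_unifSphere hn (hf.continuous.comp (hcont 0)))
    (hg.comp (hcont 0)).aestronglyMeasurable ?_ (integrable_const C) ?_).2
  · simp only [hinv] at key
    have h0 (v : EuclideanSpace ℝ (Fin n)) : planeRot i j 0 v = v := by simp [planeRot_apply]
    simp only [h0] at key
    exact key.unique (hasDerivAt_const 0 _)
  · filter_upwards [ae_unifSphere_norm_eq_one n] with v hv t _
    exact hC _ (by simpa [norm_planeRot hij] using hv)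
  · refine .of_forall fun v t _ => ?_
    rw [hg']
    exact (hf _).hasFDerivAt.comp_hasDerivAt t (hasDerivAt_planeRot hij t v)

/-! ### Moment generating function and concentration of a quadratic form -/

section

variable {n : ℕ}

/-- The quadratic form `v ↦ vᵀ M v`. -/
def quadForm (M : Matrix (Fin n) (Fin n) ℝ) (v : EuclideanSpace ℝ (Fin n)) : ℝ :=
  ∑ k, v k * (M *ᵥ v.ofLp) k

theorem contDiff_mulVec_apply (M : Matrix (Fin n) (Fin n) ℝ) (k : Fin n) :
    ContDiff ℝ 1 fun v : EuclideanSpace ℝ (Fin n) => (M *ᵥ v.ofLp) k := by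
  simp only [Matrix.mulVec, dotProduct]
  fun_prop

theorem contDiff_quadForm (M : Matrix (Fin n) (Fin n) ℝ) : ContDiff ℝ 1 (quadForm M) := by
  have := contDiff_mulVec_apply M
  unfold quadForm
  fun_prop

theorem mulVec_rotGen (M : Matrix (Fin n) (Fin n) ℝ) (i j k : Fin n)
    (v : EuclideanSpace ℝ (Fin n)) :
    (M *ᵥ (rotGen i j v).ofLp) k = v i * M k j - v j * M k i := by
  simp [Matrix.mulVec, dotProduct, rotGen_apply, mul_sub, Finset.sum_sub_distrib, mul_comm]

theorem hasDerivAt_coord_line (v w : EuclideanSpace ℝ (Fin n)) (k : Fin n) :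
    HasDerivAt (fun t : ℝ => (v + t • w) k) (w k) 0 := by
  simpa using ((hasDerivAt_id' (0 : ℝ)).mul_const (w k)).const_add (v k)

theorem hasDerivAt_mulVec_line (M : Matrix (Fin n) (Fin n) ℝ) (v w : EuclideanSpace ℝ (Fin n))
    (k : Fin n) :
    HasDerivAt (fun t : ℝ => (M *ᵥ (v + t • w).ofLp) k) ((M *ᵥ w.ofLp) k) 0 := by
  simpa [Matrix.mulVec_add, Matrix.mulVec_smul] using
    ((hasDerivAt_id' (0 : ℝ)).mul_const ((M *ᵥ w.ofLp) k)).const_add ((M *ᵥ v.ofLp) k)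

theorem sum_mul_mulVec_comm {M : Matrix (Fin n) (Fin n) ℝ} (hM : M.IsSymm)
    (v w : EuclideanSpace ℝ (Fin n)) :
    ∑ k, v k * (M *ᵥ w.ofLp) k = ∑ k, w k * (M *ᵥ v.ofLp) k := by
  simp only [Matrix.mulVec, dotProduct, Finset.mul_sum]
  rw [Finset.sum_comm]
  refine Finset.sum_congr rfl fun i _ => Finset.sum_congr rfl fun j _ => ?_
  rw [← hM.apply i j]
  ring

theorem hasDerivAt_quadForm_rotGen {M : Matrix (Fin n) (Fin n) ℝ} (hM : M.IsSymm) (i j : Fin n)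
    (v : EuclideanSpace ℝ (Fin n)) :
    HasDerivAt (fun t : ℝ => quadForm M (v + t • rotGen i j v))
      (2 * (v i * (M *ᵥ v.ofLp) j - v j * (M *ᵥ v.ofLp) i)) 0 := by
  have h := HasDerivAt.fun_sum (u := Finset.univ) fun k _ =>
    (hasDerivAt_coord_line v (rotGen i j v) k).mul (hasDerivAt_mulVec_line M v (rotGen i j v) k)
  convert! h using 1
  simp only [zero_smul, add_zero, Finset.sum_add_distrib]
  rw [sum_mul_mulVec_comm hM v]
  simp only [rotGen_apply, sub_mul, Finset.sum_sub_distrib, mul_assoc, ite_mul, mul_ite]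
  simp
  ring

/-- The function differentiated is `(vᵢ (M v)ⱼ - vⱼ (M v)ᵢ) e^{xq}`, which for `x ≠ 0` is the
rotational derivative of `e^{xq}` divided by `2x`. Summed over `i, j`, this says that the spherical
Laplacian of `e^{xq}` integrates to zero, in a form that also covers `x = 0`. -/
theorem integral_sphere_rotGen_quadForm {M : Matrix (Fin n) (Fin n) ℝ} (hM : M.IsSymm) (x : ℝ)
    (i j : Fin n) :
    ∫ v, ((v i * (if i = j then 1 else 0) - v j) * (M *ᵥ v.ofLp) j
        + v i * (v i * M j j - v j * M j i)
        - ((v i - v j * (if j = i then 1 else 0)) * (M *ᵥ v.ofLp) i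
        + v j * (v i * M i j - v j * M i i))
        + 2 * x * (v i * (M *ᵥ v.ofLp) j - v j * (M *ᵥ v.ofLp) i) ^ 2) *
        Real.exp (x * quadForm M v) ∂unifSphere n = 0 := by
  have h1 := contDiff_mulVec_apply M
  have h2 := contDiff_quadForm M
  refine integral_unifSphere_deriv_rotGen i j (f := fun v =>
    (v i * (M *ᵥ v.ofLp) j - v j * (M *ᵥ v.ofLp) i) * Real.exp (x * quadForm M v)) ?_ ?_ ?_
  · exact ContDiff.differentiable (n := 1) (by fun_prop) one_ne_zero
  · have := fun k => (h1 k).continuous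
    have := h2.continuous
    fun_prop
  · intro v
    have hd := hasDerivAt_coord_line v (rotGen i j v)
    have hm := hasDerivAt_mulVec_line M v (rotGen i j v)
    have hq := hasDerivAt_quadForm_rotGen hM i j v
    convert! (((hd i).mul (hm j)).sub ((hd j).mul (hm i))).mul (hq.const_mul x).exp using 1
    simp only [zero_smul, add_zero, mulVec_rotGen, rotGen_apply, Pi.mul_apply, Pi.sub_apply]
    simp
    ring

/-- The squares combine by Lagrange's identity with `|v| = 1`. The factor `2` arises because ordered
pairs count each coordinate plane twice. -/
theorem sum_rotGen_quadForm {M : Matrix (Fin n) (Fin n) ℝ} (hM : M.IsSymm) (x : ℝ)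
    {v : EuclideanSpace ℝ (Fin n)} (hv : ‖v‖ = 1) :
    ∑ i, ∑ j, ((v i * (if i = j then 1 else 0) - v j) * (M *ᵥ v.ofLp) j
        + v i * (v i * M j j - v j * M j i)
        - ((v i - v j * (if j = i then 1 else 0)) * (M *ᵥ v.ofLp) i
        + v j * (v i * M i j - v j * M i i))
        + 2 * x * (v i * (M *ᵥ v.ofLp) j - v j * (M *ᵥ v.ofLp) i) ^ 2) =
      2 * (M.trace - n * quadForm M v + 2 * x * (∑ k, (M *ᵥ v.ofLp) k ^ 2 - quadForm M v ^ 2)) := by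
  have hv2 : ∑ k, v k ^ 2 = 1 := by
    rw [← EuclideanSpace.real_norm_sq_eq, hv, one_pow]
  set m := M *ᵥ v.ofLp with hm
  have hq : ∑ k, v k * m k = quadForm M v := rfl
  have e1 : ∑ i, ∑ j, v i * (if i = j then 1 else 0) * m j = quadForm M v := by
    simp [← hq]
  have e2 : ∑ i : Fin n, ∑ j, v j * m j = n * quadForm M v := by
    simp [hq]
  have e3 : ∑ i, ∑ j, v i ^ 2 * M j j = M.trace := by
    simp_rw [← Finset.mul_sum, ← Finset.sum_mul, hv2, one_mul]
    rfl
  have e4 : ∑ i, ∑ j, v i * (v j * M i j) = quadForm M v := by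
    simp only [← hq, hm, Matrix.mulVec, dotProduct, Finset.mul_sum]
    simp only [mul_comm]
  have e5 : ∑ i, ∑ j, (v i ^ 2 * m j ^ 2) = ∑ k, m k ^ 2 := by
    simp_rw [← Finset.mul_sum, ← Finset.sum_mul, hv2, one_mul]
  have e6 : ∑ i, ∑ j, ((v i * m i) * (v j * m j)) = quadForm M v ^ 2 := by
    simp_rw [← Finset.mul_sum, ← Finset.sum_mul, hq, sq]
  have e2' : ∑ i : Fin n, ∑ _j : Fin n, v i * m i = n * quadForm M v := by
    rw [Finset.sum_comm, e2]
  have e1' : ∑ i, ∑ j, v j * (if j = i then 1 else 0) * m i = quadForm M v := by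
    rw [Finset.sum_comm, e1]
  have e3' : ∑ i, ∑ j, v j ^ 2 * M i i = M.trace := by rw [Finset.sum_comm, e3]
  have e5' : ∑ i, ∑ j, (v j ^ 2 * m i ^ 2) = ∑ k, m k ^ 2 := by rw [Finset.sum_comm, e5]
  calc _ = ∑ i, ∑ j, (v i * (if i = j then 1 else 0) * m j
        + v j * (if j = i then 1 else 0) * m i - v j * m j - v i * m i + v i ^ 2 * M j j
        + v j ^ 2 * M i i - 2 * (v i * (v j * M i j)) + 2 * x * (v i ^ 2 * m j ^ 2)
        + 2 * x * (v j ^ 2 * m i ^ 2) - 4 * x * ((v i * m i) * (v j * m j))) := by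
        refine Finset.sum_congr rfl fun i _ => Finset.sum_congr rfl fun j _ => ?_
        rw [hM.apply i j]
        ring
    _ = _ := by
        simp only [Finset.sum_add_distrib, Finset.sum_sub_distrib, ← Finset.mul_sum] at *
        simp only [e1, e1', e2, e2', e3, e3', e4, e5, e5', e6]
        ring

theorem integral_sphere_quadForm_identity (hn : 0 < n) {M : Matrix (Fin n) (Fin n) ℝ}
    (hM : M.IsSymm) (x : ℝ) :
    ∫ v, (M.trace - n * quadForm M v + 2 * x * (∑ k, (M *ᵥ v.ofLp) k ^ 2 - quadForm M v ^ 2)) *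
      Real.exp (x * quadForm M v) ∂unifSphere n = 0 := by
  have h1 := fun k => (contDiff_mulVec_apply M k).continuous
  have h2 := (contDiff_quadForm M).continuous
  have hsum := Finset.sum_congr rfl fun i (_ : i ∈ Finset.univ) => Finset.sum_congr rfl
    fun j (_ : j ∈ Finset.univ) => integral_sphere_rotGen_quadForm hM x i j
  simp_rw [Finset.sum_const_zero] at hsum
  have hint (i j : Fin n) := integrable_unifSphere hn (f := fun v =>
      ((v i * (if i = j then 1 else 0) - v j) * (M *ᵥ v.ofLp) j
        + v i * (v i * M j j - v j * M j i)
        - ((v i - v j * (if j = i then 1 else 0)) * (M *ᵥ v.ofLp) i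
        + v j * (v i * M i j - v j * M i i))
        + 2 * x * (v i * (M *ᵥ v.ofLp) j - v j * (M *ᵥ v.ofLp) i) ^ 2) *
        Real.exp (x * quadForm M v)) (by fun_prop)
  have hswap (i : Fin n) := integral_finsetSum Finset.univ fun j _ => hint i j
  simp_rw [← hswap] at hsum
  rw [← integral_finsetSum _ fun i _ => integrable_finsetSum _ fun j _ => hint i j] at hsum
  simp_rw [← Finset.sum_mul] at hsum
  have := integral_congr_ae (μ := unifSphere n) (f := fun v => 2 * ((M.trace - n * quadForm M v +
    2 * x * (∑ k, (M *ᵥ v.ofLp) k ^ 2 - quadForm M v ^ 2)) * Real.exp (x * quadForm M v))) <| by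
      filter_upwards [ae_unifSphere_norm_eq_one n] with v hv
      rw [← mul_assoc, ← sum_rotGen_quadForm hM x hv]
  rw [hsum, integral_const_mul] at this
  linarith

theorem hasDerivAt_integral_pow_mul_exp_quadForm (hn : 0 < n) (M : Matrix (Fin n) (Fin n) ℝ)
    (k : ℕ) (x : ℝ) :
    HasDerivAt (fun x => ∫ v, quadForm M v ^ k * Real.exp (x * quadForm M v) ∂unifSphere n)
      (∫ v, quadForm M v ^ (k + 1) * Real.exp (x * quadForm M v) ∂unifSphere n) x := by
  have h2 := (contDiff_quadForm M).continuous
  refine hasDerivAt_integral_pow_mul_exp_real ?_ k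
  have : integrableExpSet (quadForm M) (unifSphere n) = Set.univ := by
    ext t
    simp only [integrableExpSet, Set.mem_ofPred_eq, Set.mem_univ, iff_true]
    exact integrable_unifSphere hn (by fun_prop)
  simp [this]

theorem mgf_quadForm_le_of_nonneg (hn : 0 < n) {M : Matrix (Fin n) (Fin n) ℝ} (hM : M.IsSymm)
    (hle : ∀ v : EuclideanSpace ℝ (Fin n), ∑ k, (M *ᵥ v.ofLp) k ^ 2 ≤ quadForm M v) {x : ℝ}
    (hx : 0 ≤ x) :
    mgf (quadForm M) (unifSphere n) x ≤
      Real.exp (M.trace / n * x + x ^ 2 / (4 * (n + 2))) := by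
  have := isProbabilityMeasure_unifSphere hn
  have h1 := fun k => (contDiff_mulVec_apply M k).continuous
  have h2 := (contDiff_quadForm M).continuous
  have hn' : (0 : ℝ) < n := by exact_mod_cast hn
  set F : ℕ → ℝ → ℝ := fun k x =>
    ∫ v, quadForm M v ^ k * Real.exp (x * quadForm M v) ∂unifSphere n with hF
  have hFd (k : ℕ) (x : ℝ) : HasDerivAt (F k) (F (k + 1) x) x :=
    hasDerivAt_integral_pow_mul_exp_quadForm hn M k x
  -- Halving the integral identity, with `|M v|² ≤ q`, yields these Kummer parameters; `8(b + 1)`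
  -- becomes `4(n + 2)`.
  have key := kummer_subsolution_le_exp (a := M.trace / 2) (b := n / 2) (by positivity)
    (hFd 0) (hFd 1) (by simp [hF]) (fun x => integral_nonneg fun v => by positivity) ?_ hx
  · have h3 : F 0 x = mgf (quadForm M) (unifSphere n) x := by simp [hF, mgf]
    rw [h3] at key
    refine key.trans_eq ?_
    congr 1
    field_simp
    ring
  · intro x hx
    have hid := integral_sphere_quadForm_identity hn hM x
    have hi (g : EuclideanSpace ℝ (Fin n) → ℝ) (hg : Continuous g) :
        Integrable (fun v => g v * Real.exp (x * quadForm M v)) (unifSphere n) :=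
      integrable_unifSphere hn (by fun_prop)
    have hle' : 0 ≤ ∫ v, (M.trace * quadForm M v ^ 0 - n * quadForm M v ^ 1
        + 2 * x * (quadForm M v ^ 1 - quadForm M v ^ 2)) * Real.exp (x * quadForm M v)
        ∂unifSphere n := by
      rw [← hid]
      refine integral_mono (hi _ (by fun_prop)) (hi _ (by fun_prop)) fun v => ?_
      have := hle v
      have h4 : 2 * x * ∑ k, (M *ᵥ v.ofLp) k ^ 2 ≤ 2 * x * quadForm M v :=
        mul_le_mul_of_nonneg_left this (by positivity)
      refine mul_le_mul_of_nonneg_right ?_ (Real.exp_pos _).le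
      linarith
    have hexp : ∫ v, (M.trace * quadForm M v ^ 0 - n * quadForm M v ^ 1
        + 2 * x * (quadForm M v ^ 1 - quadForm M v ^ 2)) * Real.exp (x * quadForm M v)
        ∂unifSphere n = M.trace * F 0 x - n * F 1 x + 2 * x * (F 1 x - F 2 x) := by
      have hk (k : ℕ) := hi (fun v => quadForm M v ^ k) (by fun_prop)
      simp only [hF]
      have hA := ((hk 0).const_mul M.trace).sub ((hk 1).const_mul (n : ℝ))
      have hB := ((hk 1).sub (hk 2)).const_mul (2 * x)
      simp only [Pi.sub_def, Pi.sub_apply] at hA hB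
      rw [← integral_sub (hk 1) (hk 2), ← integral_const_mul, ← integral_const_mul,
        ← integral_const_mul, ← integral_sub ((hk 0).const_mul _) ((hk 1).const_mul _),
        ← integral_add hA hB]
      refine integral_congr_ae (.of_forall fun v => ?_)
      simp only
      ring
    rw [hexp] at hle'
    simp only [zero_add, Nat.reduceAdd]
    linarith

theorem quadForm_one_sub (M : Matrix (Fin n) (Fin n) ℝ) (v : EuclideanSpace ℝ (Fin n)) :
    quadForm (1 - M) v = ‖v‖ ^ 2 - quadForm M v := by
  rw [EuclideanSpace.real_norm_sq_eq]
  simp [quadForm, Matrix.sub_mulVec, mul_sub, Finset.sum_sub_distrib, sq]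

theorem sum_one_sub_mulVec_sq_le {M : Matrix (Fin n) (Fin n) ℝ}
    (hle : ∀ v : EuclideanSpace ℝ (Fin n), ∑ k, (M *ᵥ v.ofLp) k ^ 2 ≤ quadForm M v)
    (v : EuclideanSpace ℝ (Fin n)) :
    ∑ k, ((1 - M) *ᵥ v.ofLp) k ^ 2 ≤ quadForm (1 - M) v := by
  rw [quadForm_one_sub, EuclideanSpace.real_norm_sq_eq]
  have h := hle v
  have : ∑ k, ((1 - M) *ᵥ v.ofLp) k ^ 2 =
      ∑ k, v k ^ 2 - 2 * quadForm M v + ∑ k, (M *ᵥ v.ofLp) k ^ 2 := by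
    rw [quadForm, Finset.mul_sum, ← Finset.sum_sub_distrib, ← Finset.sum_add_distrib]
    refine Finset.sum_congr rfl fun k _ => ?_
    simp [Matrix.sub_mulVec]
    ring
  linarith

/-- The hypotheses are stable under `M ↦ 1 - M`, which on the sphere replaces `q` by `1 - q` and so
exchanges the signs of `x`. -/
theorem mgf_quadForm_le (hn : 0 < n) {M : Matrix (Fin n) (Fin n) ℝ} (hM : M.IsSymm)
    (hle : ∀ v : EuclideanSpace ℝ (Fin n), ∑ k, (M *ᵥ v.ofLp) k ^ 2 ≤ quadForm M v) (x : ℝ) :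
    mgf (quadForm M) (unifSphere n) x ≤
      Real.exp (M.trace / n * x + x ^ 2 / (4 * (n + 2))) := by
  rcases le_total 0 x with hx | hx
  · exact mgf_quadForm_le_of_nonneg hn hM hle hx
  have hn' : (0 : ℝ) < n := by exact_mod_cast hn
  have h := mgf_quadForm_le_of_nonneg hn (Matrix.isSymm_one.sub hM)
    (sum_one_sub_mulVec_sq_le hle) (neg_nonneg.2 hx)
  have h1 : mgf (quadForm M) (unifSphere n) x =
      Real.exp x * mgf (quadForm (1 - M)) (unifSphere n) (-x) := by
    rw [mgf, mgf, ← integral_const_mul]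
    refine integral_congr_ae ?_
    filter_upwards [ae_unifSphere_norm_eq_one n] with v hv
    rw [quadForm_one_sub, hv, ← Real.exp_add]
    ring_nf
  rw [h1]
  refine (mul_le_mul_of_nonneg_left h (Real.exp_pos x).le).trans_eq ?_
  rw [← Real.exp_add, Matrix.trace_sub, Matrix.trace_one, Fintype.card_fin]
  congr 1
  field_simp
  ring

theorem hasSubgaussianMGF_quadForm (hn : 0 < n) {M : Matrix (Fin n) (Fin n) ℝ} (hM : M.IsSymm)
    (hle : ∀ v : EuclideanSpace ℝ (Fin n), ∑ k, (M *ᵥ v.ofLp) k ^ 2 ≤ quadForm M v) :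
    HasSubgaussianMGF (fun v => quadForm M v - M.trace / n) (1 / (2 * (n + 2)))
      (unifSphere n) where
  integrable_exp_mul t := by
    have h2 := (contDiff_quadForm M).continuous
    exact integrable_unifSphere hn (by fun_prop)
  mgf_le t := by
    have h := mgf_quadForm_le hn hM hle t
    have h1 : mgf (fun v => quadForm M v - M.trace / n) (unifSphere n) t =
        Real.exp (-(M.trace / n * t)) * mgf (quadForm M) (unifSphere n) t := by
      rw [mgf, mgf, ← integral_const_mul]
      refine integral_congr_ae (.of_forall fun v => ?_)
      simp only [← Real.exp_add]
      ring_nf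
    rw [h1]
    refine (mul_le_mul_of_nonneg_left h (Real.exp_pos _).le).trans_eq ?_
    rw [← Real.exp_add]
    congr 1
    push_cast
    field_simp
    ring

theorem measureReal_abs_sub_average_quadForm_lt (hn : 0 < n) {M : Matrix (Fin n) (Fin n) ℝ}
    (hM : M.IsSymm)
    (hle : ∀ v : EuclideanSpace ℝ (Fin n), ∑ k, (M *ᵥ v.ofLp) k ^ 2 ≤ quadForm M v)
    {nv : ℕ} (hnv : 0 < nv) {Ω : Type*} [MeasurableSpace Ω] {P : Measure Ω}
    [IsProbabilityMeasure P] {v : Fin nv → Ω → EuclideanSpace ℝ (Fin n)} (hindep : iIndepFun v P)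
    (hlaw : ∀ l, HasLaw (v l) (unifSphere n) P) {ε : ℝ} (hε : 0 < ε) :
    P.real {ω | ε < |M.trace / n - 1 / (nv : ℝ) * ∑ l, quadForm M (v l ω)|} ≤
      2 * Real.exp (-((nv : ℝ) * ((n : ℝ) + 2) * ε ^ 2)) := by
  have hnv' : (0 : ℝ) < nv := by exact_mod_cast hnv
  have hq := (contDiff_quadForm M).continuous
  have hsub (l : Fin nv) : HasSubgaussianMGF (fun ω => quadForm M (v l ω) - M.trace / n)
      (1 / (2 * (n + 2))) P :=
    HasSubgaussianMGF.of_map (X := fun w => quadForm M w - M.trace / n) (hlaw l).aemeasurable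
      ((hlaw l).map_eq.symm ▸ hasSubgaussianMGF_quadForm hn hM hle)
  have hind : iIndepFun (fun l ω => quadForm M (v l ω) - M.trace / n) P :=
    hindep.comp (fun _ w => quadForm M w - M.trace / n) fun _ => by fun_prop
  have hind' : iIndepFun (fun l => -fun ω => quadForm M (v l ω) - M.trace / n) P :=
    hindep.comp (fun _ w => -(quadForm M w - M.trace / n)) fun _ => by fun_prop
  have h1 := HasSubgaussianMGF.measure_sum_ge_le_of_iIndepFun hind (s := Finset.univ)
    (fun l _ => hsub l) (mul_pos hnv' hε).le
  have h2 := HasSubgaussianMGF.measure_sum_ge_le_of_iIndepFun hind' (s := Finset.univ)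
    (fun l _ => (hsub l).neg) (mul_pos hnv' hε).le
  -- Independent variance proxies add up to `nv / (2(n + 2))`.
  have hexp : -((nv : ℝ) * ε) ^ 2 / (2 * ((∑ _l : Fin nv, 1 / (2 * ((n : NNReal) + 2)) : NNReal) : ℝ))
      = -((nv : ℝ) * ((n : ℝ) + 2) * ε ^ 2) := by
    simp
    field_simp
  rw [hexp] at h1 h2
  have hsum (ω : Ω) : ∑ l, (quadForm M (v l ω) - M.trace / n) =
      nv * (1 / (nv : ℝ) * ∑ l, quadForm M (v l ω) - M.trace / n) := by
    simp [Finset.sum_sub_distrib]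
    field_simp
  refine (measureReal_mono (s₂ := {ω | nv * ε ≤ ∑ l, (quadForm M (v l ω) - M.trace / n)} ∪
    {ω | nv * ε ≤ ∑ l, (-fun ω => quadForm M (v l ω) - M.trace / n) ω}) ?_).trans
    ((measureReal_union_le _ _).trans (by linarith))
  intro ω hω
  simp only [Pi.neg_apply, Finset.sum_neg_distrib, hsum, Set.mem_union, Set.mem_ofPred_eq,
    ← mul_neg] at hω ⊢
  rcases lt_abs.1 hω with h | h
  · exact Or.inr (mul_le_mul_of_nonneg_left (by linarith) hnv'.le)
  · exact Or.inl (mul_le_mul_of_nonneg_left (by linarith) hnv'.le)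

end

/-! ### Spectral projections as real quadratic forms -/

section

variable {𝕜 : Type*} [RCLike 𝕜] {n : ℕ}

/-- The entrywise real part of the orthogonal projection `∑_{i ∈ S} uᵢ uᵢᴴ`. -/
noncomputable def reProj (b : OrthonormalBasis (Fin n) 𝕜 (EuclideanSpace 𝕜 (Fin n))) (S : Finset (Fin n)) :
    Matrix (Fin n) (Fin n) ℝ :=
  fun k l => RCLike.re (∑ i ∈ S, b i k * (starRingEnd 𝕜) (b i l))

variable (b : OrthonormalBasis (Fin n) 𝕜 (EuclideanSpace 𝕜 (Fin n))) (S : Finset (Fin n))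

theorem isSymm_reProj : (reProj b S).IsSymm := by
  ext k l
  simp only [Matrix.transpose_apply, reProj, map_sum]
  refine Finset.sum_congr rfl fun i _ => ?_
  rw [← RCLike.conj_re, map_mul, RCLike.conj_conj, mul_comm]

theorem trace_reProj : (reProj b S).trace = S.card := by
  have h (i : Fin n) : ∑ k, RCLike.re (b i k * (starRingEnd 𝕜) (b i k)) = 1 := by
    have := EuclideanSpace.norm_sq_eq (b i)
    rw [b.norm_eq_one, one_pow] at this
    rw [this]
    refine Finset.sum_congr rfl fun k _ => ?_
    rw [RCLike.mul_conj, ← RCLike.ofReal_pow, RCLike.ofReal_re]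
  simp only [Matrix.trace, Matrix.diag, reProj, map_sum]
  rw [Finset.sum_comm, Finset.sum_congr rfl fun i _ => h i]
  simp

theorem norm_toField (v : EuclideanSpace ℝ (Fin n)) : ‖toField 𝕜 v‖ = ‖v‖ := by
  rw [← sq_eq_sq₀ (norm_nonneg _) (norm_nonneg _), EuclideanSpace.norm_sq_eq,
    EuclideanSpace.norm_sq_eq]
  simp [toField]

theorem reProj_mulVec_apply (v : EuclideanSpace ℝ (Fin n)) (k : Fin n) :
    (reProj b S *ᵥ v.ofLp) k =
      RCLike.re ((∑ i ∈ S, inner 𝕜 (b i) (toField 𝕜 v) • b i : EuclideanSpace 𝕜 (Fin n)) k) := by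
  simp only [Matrix.mulVec, dotProduct, reProj, PiLp.inner_apply, RCLike.inner_apply, toField,
    WithLp.ofLp_sum, Finset.sum_apply, PiLp.smul_apply, smul_eq_mul, map_sum, Finset.sum_mul]
  rw [Finset.sum_comm]
  refine Finset.sum_congr rfl fun i _ => Finset.sum_congr rfl fun l _ => ?_
  rw [← RCLike.re_mul_ofReal]
  congr 1
  ring

theorem quadForm_reProj (v : EuclideanSpace ℝ (Fin n)) :
    quadForm (reProj b S) v = ∑ i ∈ S, ‖inner 𝕜 (toField 𝕜 v) (b i)‖ ^ 2 := by
  have h : quadForm (reProj b S) v = RCLike.re (inner 𝕜 (toField 𝕜 v)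
      (∑ i ∈ S, inner 𝕜 (b i) (toField 𝕜 v) • b i)) := by
    rw [PiLp.inner_apply, map_sum, quadForm]
    refine Finset.sum_congr rfl fun k _ => ?_
    rw [reProj_mulVec_apply]
    simp [toField, mul_comm]
  rw [h, inner_sum, map_sum]
  refine Finset.sum_congr rfl fun i _ => ?_
  rw [inner_smul_right, inner_mul_symm_re_eq_norm, norm_mul, norm_inner_symm, sq]

/-- For complex eigenvectors the real part of a projection `Π` need not be idempotent. The
inequality survives because `v` is real: `|Re(Π v)|² ≤ |Π v|² = vᴴ Π v`. -/
theorem sum_reProj_mulVec_sq_le (v : EuclideanSpace ℝ (Fin n)) :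
    ∑ k, (reProj b S *ᵥ v.ofLp) k ^ 2 ≤ quadForm (reProj b S) v := by
  set p : EuclideanSpace 𝕜 (Fin n) := ∑ i ∈ S, inner 𝕜 (b i) (toField 𝕜 v) • b i with hp
  have h1 : ‖p‖ ^ 2 = quadForm (reProj b S) v := by
    rw [quadForm_reProj, @norm_sq_eq_re_inner 𝕜, hp, b.orthonormal.inner_sum, map_sum]
    refine Finset.sum_congr rfl fun i _ => ?_
    rw [RCLike.conj_mul, ← RCLike.ofReal_pow, RCLike.ofReal_re, norm_inner_symm]
  rw [← h1, EuclideanSpace.norm_sq_eq]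
  refine Finset.sum_le_sum fun k _ => ?_
  rw [reProj_mulVec_apply]
  exact sq_le_sq' (neg_le_of_abs_le (RCLike.abs_re_le_norm _))
    ((le_abs_self _).trans (RCLike.abs_re_le_norm _))

/-! ### Reduction of the Wasserstein distance to the eigenvalues -/

variable {A : Matrix (Fin n) (Fin n) 𝕜} (hA : A.IsHermitian)

theorem CESM_eq_card_div (x : ℝ) :
    CESM hA x = ((Finset.univ.filter fun i => hA.eigenvalues i ≤ x).card : ℝ) / n := by
  simp only [CESM, mul_ite, mul_one, mul_zero, ← Finset.sum_filter]
  simp [div_eq_mul_inv]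

theorem weightedCESM_eq_sum_filter (v : EuclideanSpace ℝ (Fin n)) (x : ℝ) :
    weightedCESM hA v x = ∑ i ∈ Finset.univ.filter fun i => hA.eigenvalues i ≤ x,
      ‖inner 𝕜 (toField 𝕜 v) (hA.eigenvectorBasis i)‖ ^ 2 := by
  simp only [weightedCESM, mul_ite, mul_one, mul_zero, ← Finset.sum_filter]

theorem dW_CESM_avgWeightedCESM_le (hn : 0 < n) {nv : ℕ} (hnv : 0 < nv)
    {v : Fin nv → EuclideanSpace ℝ (Fin n)} (hv : ∀ l, ‖v l‖ = 1) {ε : ℝ} (hε : 0 < ε)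
    (h : ∀ j, |CESM hA (hA.eigenvalues j) - avgWeightedCESM hA v (hA.eigenvalues j)| ≤ ε) :
    dW (CESM hA) (avgWeightedCESM hA v) ≤ ENNReal.ofReal (ε * (lamMax hA - lamMin hA)) := by
  have hn' : (0 : ℝ) < n := by exact_mod_cast hn
  have hnv' : (0 : ℝ) < nv := by exact_mod_cast hnv
  have hmin (i : Fin n) : lamMin hA ≤ hA.eigenvalues i := ciInf_le (Set.finite_range _).bddBelow i
  have hmax (i : Fin n) : hA.eigenvalues i ≤ lamMax hA := le_ciSup (Set.finite_range _).bddAbove i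
  have hbound (x : ℝ) : ENNReal.ofReal |CESM hA x - avgWeightedCESM hA v x| ≤
      (Set.Ico (lamMin hA) (lamMax hA)).indicator (fun _ => ENNReal.ofReal ε) x := by
    by_cases hx : x ∈ Set.Ico (lamMin hA) (lamMax hA)
    · rw [Set.indicator_of_mem hx]
      refine ENNReal.ofReal_le_ofReal ?_
      obtain ⟨i₀, hi₀⟩ : ∃ i, hA.eigenvalues i = lamMin hA := by
        have : Nonempty (Fin n) := ⟨⟨0, hn⟩⟩
        exact exists_eq_ciInf_of_finite
      -- The largest eigenvalue not exceeding `x` cuts out the same index set as `x`, so both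
      -- functions take the same values at the two points.
      obtain ⟨j, hj, hjmax⟩ := Finset.exists_max_image
        (Finset.univ.filter fun i => hA.eigenvalues i ≤ x) hA.eigenvalues
        ⟨i₀, by simpa [hi₀] using hx.1⟩
      have hfil : (Finset.univ.filter fun i => hA.eigenvalues i ≤ x) =
          Finset.univ.filter fun i => hA.eigenvalues i ≤ hA.eigenvalues j := by
        ext i
        simp only [Finset.mem_filter, Finset.mem_univ, true_and] at hj hjmax ⊢
        exact ⟨hjmax i, fun hi => hi.trans hj⟩
      have := h j
      simpa only [avgWeightedCESM, CESM_eq_card_div, weightedCESM_eq_sum_filter, hfil] using this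
    · rw [Set.indicator_of_notMem hx, nonpos_iff_eq_zero, ENNReal.ofReal_eq_zero,
        abs_nonpos_iff, sub_eq_zero]
      rw [Set.mem_Ico, not_and_or, not_le, not_lt] at hx
      simp only [avgWeightedCESM, CESM_eq_card_div, weightedCESM_eq_sum_filter]
      rcases hx with hx | hx
      · have hfil : (Finset.univ.filter fun i => hA.eigenvalues i ≤ x) = ∅ :=
          Finset.filter_eq_empty_iff.2 fun i _ => not_le.2 (hx.trans_le (hmin i))
        simp [hfil]
      -- Beyond `λ_max` both functions equal `1`; for the weighted one this is Parseval with `‖v l‖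
      -- = 1`.
      · have hfil : (Finset.univ.filter fun i => hA.eigenvalues i ≤ x) = Finset.univ :=
          Finset.filter_eq_self.2 fun i _ => (hmax i).trans hx
        simp only [hfil, OrthonormalBasis.sum_sq_norm_inner_left, norm_toField, hv]
        simp [hn'.ne', hnv'.ne']
  calc dW (CESM hA) (avgWeightedCESM hA v) ≤ ∫⁻ x, (Set.Ico (lamMin hA) (lamMax hA)).indicator
        (fun _ => ENNReal.ofReal ε) x := lintegral_mono hbound
    _ = ENNReal.ofReal (ε * (lamMax hA - lamMin hA)) := by
      rw [lintegral_indicator_const measurableSet_Ico, Real.volume_Ico, ENNReal.ofReal_mul hε.le]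

end

theorem mainTheorem4 {𝕜 : Type*} [RCLike 𝕜] {n : ℕ} (hn : 0 < n)
    {A : Matrix (Fin n) (Fin n) 𝕜} (hA : A.IsHermitian)
    {nv : ℕ} (hnv : 0 < nv)
    {Ω : Type*} [MeasurableSpace Ω] (P : Measure Ω) [IsProbabilityMeasure P]
    (v : Fin nv → Ω → EuclideanSpace ℝ (Fin n))
    (hindep : iIndepFun v P)
    (hlaw : ∀ l, HasLaw (v l) (unifSphere n) P)
    (ε : ℝ) (hε : 0 < ε) :
    P.real {ω | ENNReal.ofReal (ε * (lamMax hA - lamMin hA)) <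
        dW (CESM hA) (avgWeightedCESM hA (fun l => v l ω))} ≤
      2 * (n : ℝ) * Real.exp (-((nv : ℝ) * ((n : ℝ) + 2) * ε ^ 2)) := by
  have hnorm : ∀ᵐ ω ∂P, ∀ l, ‖v l ω‖ = 1 := by
    refine ae_all_iff.2 fun l => ?_
    refine ae_of_ae_map (hlaw l).aemeasurable (p := fun w => ‖w‖ = 1) ?_
    rw [(hlaw l).map_eq]
    exact ae_unifSphere_norm_eq_one n
  set B : Fin n → Set Ω := fun j => {ω | ε < |CESM hA (hA.eigenvalues j) -
    avgWeightedCESM hA (fun l => v l ω) (hA.eigenvalues j)|} with hB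
  have hsub : {ω | ENNReal.ofReal (ε * (lamMax hA - lamMin hA)) <
      dW (CESM hA) (avgWeightedCESM hA (fun l => v l ω))} ≤ᵐ[P] ⋃ j, B j := by
    filter_upwards [hnorm] with ω hω hlt
    by_contra hcon
    have hcon' : ω ∉ ⋃ j, B j := hcon
    simp only [hB, Set.mem_iUnion, Set.mem_ofPred_eq, not_exists, not_lt] at hcon'
    exact absurd (dW_CESM_avgWeightedCESM_le hA hn hnv hω hε hcon') (not_le.2 hlt)
  have htail (j : Fin n) : P.real (B j) ≤
      2 * Real.exp (-((nv : ℝ) * ((n : ℝ) + 2) * ε ^ 2)) := by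
    set S := Finset.univ.filter fun i => hA.eigenvalues i ≤ hA.eigenvalues j with hS
    have h := measureReal_abs_sub_average_quadForm_lt hn (isSymm_reProj hA.eigenvectorBasis S)
      (sum_reProj_mulVec_sq_le hA.eigenvectorBasis S) hnv hindep hlaw hε
    simpa only [hB, avgWeightedCESM, CESM_eq_card_div, weightedCESM_eq_sum_filter, trace_reProj,
      quadForm_reProj] using h
  calc _ ≤ P.real (⋃ j, B j) := ENNReal.toReal_mono (measure_ne_top _ _) (measure_mono_ae hsub)
    _ ≤ ∑ j, P.real (B j) := measureReal_iUnion_fintype_le _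
    _ ≤ ∑ _j : Fin n, 2 * Real.exp (-((nv : ℝ) * ((n : ℝ) + 2) * ε ^ 2)) :=
      Finset.sum_le_sum fun j _ => htail j
    _ = _ := by
      simp
      ring
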